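/- All graphs are finite, undirected, without loops or multiple edges; $N_G(u)$ denotes the set of neighbours of a vertex $u$ in $G$, and $\Delta(G)$ the maximum degree of $G$. The square $H^2$ of a graph $H$ is the graph with vertex set $V_H$ in which two distinct vertices are adjacent if and only if their distance in $H$ is at most $2$; a graph $H$ is a square root of $G$ if $H^2=G$. An edge $uv$ of a graph $G$ is called recognizable if $N_G(u)\cap N_G(v)$ has a partition into two nonempty sets $X$ and $Y$ such that a) $X$ and $Y$ are (disjoint) cliques in $G$; b) $xy\notin E_G$ for all $x\in X$ and $y\in Y$; c) for every $w\in N_G(u)\setminus(X\cup Y\cup\{v\})$ and every $y\in Y$, $wy\notin E_G$; d) for every $w\in N_G(v)\setminus(X\cup Y\cup\{u\})$ and every $x\in X$, $wx\notin E_G$; e) for every $w\in N_G(u)\setminus(X\cup Y\cup\{v\})$ there is an $x\in X$ with $wx\in E_G$; f) for every $w\in N_G(v)\setminus(X\cup Y\cup\{u\})$ there is a $y\in Y$ with $wy\in E_G$. Let $G$ be a connected graph with $\Delta(G)\le 6$ that has no recognizable edges. If $G$ has a square root, then $G$ has at most $103$ vertices. -/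

import Mathlib

namespace SquareRoot

/-- The square of `H`: two distinct vertices are adjacent iff their distance in `H` is at most 2.
The extended distance is used, which is `⊤` between different components of `H`. -/
def square {V : Type*} (H : SimpleGraph V) : SimpleGraph V where
  Adj x y := x ≠ y ∧ H.edist x y ≤ 2
  symm := ⟨fun x y h => ⟨h.1.symm, by rw [SimpleGraph.edist_comm]; exact h.2⟩⟩
  loopless := ⟨fun _ h => h.1 rfl⟩

/-- `H` is a square root of `G` if `H² = G`. -/
def IsSquareRoot {V : Type*} (H G : SimpleGraph V) : Prop :=
  square H = G

/-- The data `(X, Y)` witnesses that the edge `uv` of `G` is recognizable: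
`N(u) ∩ N(v)` is partitioned into the two nonempty sets `X` and `Y`, with the required adjacencies. -/
structure IsRecognizingPartition {V : Type*} (G : SimpleGraph V) (u v : V) (X Y : Set V) :
    Prop where
  union_eq : X ∪ Y = G.neighborSet u ∩ G.neighborSet v
  disjoint : Disjoint X Y
  nonempty_left : X.Nonempty
  nonempty_right : Y.Nonempty
  clique_left : G.IsClique X
  clique_right : G.IsClique Y
  not_adj : ∀ x ∈ X, ∀ y ∈ Y, ¬ G.Adj x y
  not_adj_right : ∀ w ∈ G.neighborSet u \ (X ∪ Y ∪ {v}), ∀ y ∈ Y, ¬ G.Adj w y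
  not_adj_left : ∀ w ∈ G.neighborSet v \ (X ∪ Y ∪ {u}), ∀ x ∈ X, ¬ G.Adj w x
  exists_adj_left : ∀ w ∈ G.neighborSet u \ (X ∪ Y ∪ {v}), ∃ x ∈ X, G.Adj w x
  exists_adj_right : ∀ w ∈ G.neighborSet v \ (X ∪ Y ∪ {u}), ∃ y ∈ Y, G.Adj w y

/-- `uv` is a recognizable edge of `G`. -/
def IsRecognizableEdge {V : Type*} (G : SimpleGraph V) (u v : V) : Prop :=
  G.Adj u v ∧ ∃ X Y : Set V, IsRecognizingPartition G u v X Y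

end SquareRoot

/-! The core is that a square root `H` of `G` has diameter at most 7; a count over distance levels
then gives 103.

If an edge `uv` of `H`, whose ends both have further neighbours, lies on no cycle of length at most
6, then the remaining `H`-neighbours of `u` and of `v` form a recognizing partition
(`hasShortPath_of_not_isRecognizableEdge`). Hence every such edge lies on a short cycle.

Suppose `H` had a geodesic of length 8, indexed from -4 to 4. Each edge from `i` to `i + 1` with `-3
≤ i ≤ 2` lies on a short cycle, and cutting that cycle along the geodesic leaves an ear with at most
three inner vertices (`ear_of_hasShortPath`). On the other hand, a path vertex with index in `[-2,
2]` already has four path vertices among its at most six neighbours in `G`, so at most two vertices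
off the path are within distance two of it (`IsGeodesic.cap`). Six ears do not fit into this little
room (`false_of_earSystem`): both central edges must have ears with a single inner vertex, and these
leave no place for the outer ears.

For the count, a vertex at distance `j` from the root has at least `min j 2` neighbours in `G` on
lower levels, which bounds how fast the levels grow. -/

namespace SquareRoot

/-! ### Ears over a geodesic of length eight -/

/-- An ear over the path edge from `i` to `i + 1`: a path with one, two or three inner vertices off
the path, from a path vertex `a ≤ i` to a path vertex `b ≥ i + 1`. -/
def HasEar {V : Type*} (N : ℤ → V → Prop) (M : V → V → Prop) (i : ℤ) : Prop :=
  ∃ a b : ℤ, a ≤ i ∧ i + 1 ≤ b ∧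
    ((∃ z, N a z ∧ N b z) ∨
     (b ≤ a + 3 ∧ ∃ x y, N a x ∧ M x y ∧ N b y) ∨
     (b = a + 2 ∧ ∃ x y z, x ≠ z ∧ N a x ∧ M x y ∧ M y z ∧ N b z))

/-- The vertices off a geodesic path with vertices indexed by integers: `N a x` says that `x` is
adjacent to the path vertex `a`, `M x y` that `x` and `y` are adjacent, `E a x` that `x` has
distance at most two from the path vertex `a`, and `l` is a level function. -/
structure EarSystem {V : Type*} (N : ℤ → V → Prop) (M : V → V → Prop) (E : ℤ → V → Prop)
    (l : V → ℤ) : Prop where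
  N_le : ∀ a x, N a x → l x ≤ a + 1
  N_ge : ∀ a x, N a x → a - 1 ≤ l x
  M_symm : ∀ x y, M x y → M y x
  M_ne : ∀ x y, M x y → x ≠ y
  M_le : ∀ x y, M x y → l x ≤ l y + 1
  E_of_N : ∀ a x, N a x → E a x
  E_of_N_succ : ∀ a x, N (a + 1) x → E a x
  E_of_N_pred : ∀ a x, N (a - 1) x → E a x
  E_of_M : ∀ a x y, N a x → M x y → E a y
  cap : ∀ i, -2 ≤ i → i ≤ 2 → ∀ x y z, E i x → E i y → E i z → x = y ∨ x = z ∨ y = z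
  ear : ∀ i, -3 ≤ i → i ≤ 2 → HasEar N M i

namespace EarSystem

variable {V : Type*} {N : ℤ → V → Prop} {M : V → V → Prop} {E : ℤ → V → Prop} {l : V → ℤ}

/-- Reflection exchanges the edges `i` and `-1 - i`, so the range `-3 ≤ i ≤ 2` is preserved and the
central edges 0 and -1 are swapped. -/
theorem mirror (h : EarSystem N M E l) :
    EarSystem (fun a => N (-a)) M (fun a => E (-a)) (fun x => -l x) where
  N_le a x hx := by have := h.N_ge _ _ hx; omega
  N_ge a x hx := by have := h.N_le _ _ hx; omega
  M_symm := h.M_symm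
  M_ne := h.M_ne
  M_le x y hx := by have := h.M_le _ _ (h.M_symm _ _ hx); omega
  E_of_N a x hx := h.E_of_N _ _ hx
  E_of_N_succ a x hx := h.E_of_N_pred _ _ (by rwa [show -a - 1 = -(a + 1) by ring])
  E_of_N_pred a x hx := h.E_of_N_succ _ _ (by rwa [show -a + 1 = -(a - 1) by ring])
  E_of_M a x y hx := h.E_of_M _ _ _ hx
  cap i h1 h2 := h.cap _ (by omega) (by omega)
  ear i h1 h2 := by
    obtain ⟨a, b, ha, hb, hab⟩ := h.ear (-1 - i) (by omega) (by omega)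
    refine ⟨-b, -a, by omega, by omega, ?_⟩
    simp only [neg_neg]
    rcases hab with ⟨z, h1, h2⟩ | ⟨h0, x, y, h1, h2, h3⟩ | ⟨h0, x, y, z, hn, h1, h2, h3, h4⟩
    · exact Or.inl ⟨z, h2, h1⟩
    · exact Or.inr (Or.inl ⟨by omega, y, x, h3, h.M_symm _ _ h2, h1⟩)
    · exact Or.inr (Or.inr ⟨by omega, z, y, x, hn.symm, h4, h.M_symm _ _ h3, h.M_symm _ _ h2, h1⟩)

theorem E_of_N_near (h : EarSystem N M E l) {a b : ℤ} {x : V} (hx : N a x) (h1 : a ≤ b + 1)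
    (h2 : b ≤ a + 1) : E b x := by
  obtain rfl | rfl | rfl : a = b ∨ a = b + 1 ∨ a = b - 1 := by omega
  exacts [h.E_of_N _ _ hx, h.E_of_N_succ _ _ hx, h.E_of_N_pred _ _ hx]

/-- If the closed set `{x, y}` contains one end of an ear, it contains the whole ear. -/
theorem ear_in_pair (h : EarSystem N M E l) {x y : V} (hx : ∀ z, M x z → z = y)
    (hy : ∀ z, M y z → z = x) {i : ℤ} (hi : -3 ≤ i) (hi' : i ≤ 2)
    (hK : ∀ a b z w, a ≤ i → i + 1 ≤ b → b ≤ a + 3 → N a z → N b w →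
      z = x ∨ z = y ∨ w = x ∨ w = y) :
    ∃ a b, a ≤ i ∧ i + 1 ≤ b ∧ (N a x ∨ N a y) ∧ (N b x ∨ N b y) := by
  obtain ⟨a, b, ha, hb, hab⟩ := h.ear i hi hi'
  refine ⟨a, b, ha, hb, ?_⟩
  rcases hab with ⟨z, h1, h2⟩ | ⟨h0, u, w, h1, h2, h3⟩ | ⟨h0, u, v, w, hn, h1, h2, h3, h4⟩
  · have := h.N_le _ _ h2
    have := h.N_ge _ _ h2
    have := h.N_le _ _ h1
    have := h.N_ge _ _ h1
    rcases hK a b z z ha hb (by omega) h1 h2 with rfl | rfl | rfl | rfl <;> simp_all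
  · have := h.M_symm _ _ h2
    rcases hK a b u w ha hb (by omega) h1 h3 with rfl | rfl | rfl | rfl <;> grind
  · have := h.M_symm _ _ h2
    have := h.M_symm _ _ h3
    rcases hK a b u w ha hb (by omega) h1 h4 with rfl | rfl | rfl | rfl <;> grind

theorem cap_pair (h : EarSystem N M E l) {i : ℤ} (hi : -2 ≤ i) (hi' : i ≤ 2) {x y : V}
    (hne : x ≠ y) (hx : E i x) (hy : E i y) {z : V} (hz : E i z) : z = x ∨ z = y := by
  rcases h.cap i hi hi' x y z hx hy hz with h | h | h
  exacts [absurd h hne, Or.inl h.symm, Or.inr h.symm]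

/-- There is no ear with two inner vertices over the edge `0` whose ends are both capped. -/
theorem no_two_ear_capped (h : EarSystem N M E l) {a b : ℤ} {x y : V} (ha : -2 ≤ a) (ha' : a ≤ 0)
    (hb : 1 ≤ b) (hb' : b ≤ 2) (hab : b ≤ a + 3) (hx : N a x) (hxy : M x y) (hy : N b y) :
    False := by
  have hne := h.M_ne _ _ hxy
  have hyx := h.M_symm _ _ hxy
  -- Both `x` and `y` are near each end, so they exhaust the room there. Hence `{x, y}` is closed
  -- under `M` and contains all off-path neighbours of path vertices from `a - 1` to `b + 1`.
  have Ka : ∀ z, E a z → z = x ∨ z = y := fun z =>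
    h.cap_pair ha (by omega) hne (h.E_of_N _ _ hx) (h.E_of_M _ _ _ hx hxy)
  have Kb : ∀ z, E b z → z = x ∨ z = y := fun z =>
    h.cap_pair (by omega) hb' hne (h.E_of_M _ _ _ hy hyx) (h.E_of_N _ _ hy)
  have cx : ∀ z, M x z → z = y := fun z hz =>
    (Ka z (h.E_of_M _ _ _ hx hz)).resolve_left (h.M_ne _ _ hz).symm
  have cy : ∀ z, M y z → z = x := fun z hz =>
    (Kb z (h.E_of_M _ _ _ hy hz)).resolve_right (h.M_ne _ _ hz).symm
  have K : ∀ c z, a - 1 ≤ c → c ≤ b + 1 → N c z → z = x ∨ z = y := by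
    intro c z h1 h2 hz
    rcases le_or_gt c (a + 1) with h3 | h3
    · exact Ka z (h.E_of_N_near hz (by omega) (by omega))
    · exact Kb z (h.E_of_N_near hz (by omega) (by omega))
  -- Levels of `x` and `y` differ by at most one, so path vertices attached to them are at most
  -- three apart.
  have key : ∀ c d, d ≤ c - 4 → (N c x ∨ N c y) → (N d x ∨ N d y) → False := by
    intro c d hcd h1 h2
    have := h.M_le _ _ hxy
    have := h.M_le _ _ hyx
    rcases h1 with h1 | h1 <;> rcases h2 with h2 | h2 <;>
    · have := h.N_ge _ _ h1
      have := h.N_le _ _ h2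
      omega
  obtain ⟨c, d, hc, hd, hcx, hdx⟩ := h.ear_in_pair cx cy (i := b) (by omega) (by omega) (by
    intro c d z w hc hd hcd hz hw
    have := K c z (by omega) (by omega) hz
    tauto)
  -- The ear over the edge `b` forces an attachment at `b + 1` or later. For a gap of at least four,
  -- the left ear may be the one over `a - 1` unless `b = a + 1`, when `a = 0` leaves room to use `a
  -- - 2`.
  rcases eq_or_ne (b - a) 1 with h1 | h1
  · obtain ⟨e, f, he, hf, hex, hfx⟩ := h.ear_in_pair cx cy (i := a - 2) (by omega) (by omega) (by
      intro c d z w hc hd hcd hz hw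
      have := K d w (by omega) (by omega) hw
      tauto)
    exact key d e (by omega) hdx hex
  · obtain ⟨e, f, he, hf, hex, hfx⟩ := h.ear_in_pair cx cy (i := a - 1) (by omega) (by omega) (by
      intro c d z w hc hd hcd hz hw
      have := K d w (by omega) (by omega) hw
      tauto)
    exact key d e (by omega) hdx hex

/-- The end 3 carries no cap, so the argument uses only vertex 0. There `{x, y}` fills the room,
while the levels of `x` and `y` are too high for an ear over the edge -1 to start at them from the
left. -/
theorem no_two_ear_zero_three (h : EarSystem N M E l) {x y : V} (hx : N 0 x) (hxy : M x y)
    (hy : N 3 y) : False := by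
  have hne := h.M_ne _ _ hxy
  have hyx := h.M_symm _ _ hxy
  have K : ∀ z, E 0 z → z = x ∨ z = y := fun z =>
    h.cap_pair (by omega) (by omega) hne (h.E_of_N _ _ hx) (h.E_of_M _ _ _ hx hxy)
  have cx : ∀ z, M x z → z = y := fun z hz =>
    (K z (h.E_of_M _ _ _ hx hz)).resolve_left (h.M_ne _ _ hz).symm
  have ly := h.N_ge _ _ hy
  have lx := h.M_le _ _ hyx
  have low : ∀ a z, a ≤ -1 → N a z → z ≠ x ∧ z ≠ y ∧ ¬ M z y := by
    intro a z ha hz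
    have := h.N_le _ _ hz
    refine ⟨?_, ?_, fun hzy => ?_⟩
    · rintro rfl; omega
    · rintro rfl; omega
    · have := h.M_le _ _ (h.M_symm _ _ hzy); omega
  have KN : ∀ c z, -1 ≤ c → c ≤ 1 → N c z → z = x ∨ z = y := fun c z h1 h2 hz =>
    K z (h.E_of_N_near hz (by omega) (by omega))
  obtain ⟨a, b, ha, hb, hab⟩ := h.ear (-1) (by omega) (by omega)
  rcases hab with ⟨z, h1, h2⟩ | ⟨h0, u, w, h1, h2, h3⟩ | ⟨h0, u, v, w, hn, h1, h2, h3, h4⟩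
  · have := h.N_ge _ _ h2
    have := h.N_le _ _ h1
    have := KN b z (by omega) (by omega) h2
    have := low a z ha h1
    tauto
  · have hl := low a u ha h1
    by_cases hb1 : b ≤ 1
    · rcases KN b w (by omega) hb1 h3 with rfl | rfl
      · exact hl.2.1 (cx u (h.M_symm _ _ h2))
      · exact hl.2.2 h2
    · have := KN a u (by omega) (by omega) h1
      tauto
  · have hl := low a u ha h1
    by_cases hb1 : b ≤ 0
    · have := h.N_le _ _ h1
      have := h.M_le _ _ (h.M_symm _ _ h2)
      rcases KN b w (by omega) (by omega) h4 with rfl | rfl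
      · obtain rfl := cx v (h.M_symm _ _ h3)
        exact hl.2.2 h2
      · have := h.N_le _ _ h4
        omega
    · have := KN a u (by omega) (by omega) h1
      tauto

theorem no_two_ear (h : EarSystem N M E l) {a b : ℤ} {x y : V} (ha : a ≤ 0)
    (hb : 1 ≤ b) (hab : b ≤ a + 3) (hx : N a x) (hxy : M x y) (hy : N b y) : False := by
  rcases eq_or_ne b 3 with rfl | hb3
  · obtain rfl : a = 0 := by omega
    exact h.no_two_ear_zero_three hx hxy hy
  · exact h.no_two_ear_capped (by omega) ha hb (by omega) hab hx hxy hy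

/-- An ear over the edge `j` to the left of the vertex `a` bounds the level of `y`. -/
theorem level_le_of_ear (h : EarSystem N M E l) {a j : ℤ} {x y : V} (hj : -3 ≤ j) (hj' : j ≤ 2)
    (hja : j = a - 2 ∨ j = a - 1) (hxy : M x y)
    (Ka : ∀ w, E a w → w = x ∨ w = y) (cx : ∀ w, M x w → w = y)
    (yN : ∀ c, a ≤ c → c ≤ a + 2 → ¬ N c y) : l y ≤ j + 2 := by
  have hyx := h.M_symm _ _ hxy
  have lyx := h.M_le _ _ hyx
  obtain ⟨s, b, hs, hb, hab⟩ := h.ear j hj hj'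
  have KN : ∀ c w, a - 1 ≤ c → c ≤ a + 1 → N c w → w = x ∨ w = y := fun c w h1 h2 hw =>
    Ka w (h.E_of_N_near hw (by omega) (by omega))
  rcases hab with ⟨w, h1, h4⟩ | ⟨h0, u, w, h1, h2, h4⟩ | ⟨h0, u, v, w, hn, h1, h2, h3, h4⟩
  · have hw := h.N_le _ _ h1
    have := h.N_ge _ _ h4
    rcases KN b w (by omega) (by omega) h4 with rfl | rfl <;> omega
  · have hu := h.N_le _ _ h1
    have hwu := h.M_symm _ _ h2
    have := h.M_le _ _ hwu
    by_cases hb1 : b ≤ a + 1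
    · rcases KN b w (by omega) hb1 h4 with rfl | rfl
      · obtain rfl := cx u hwu
        omega
      · omega
    · rcases KN s u (by omega) (by omega) h1 with rfl | rfl <;> omega
  · have hu := h.N_le _ _ h1
    have hvu := h.M_symm _ _ h2
    have := h.M_le _ _ hvu
    have hwv := h.M_symm _ _ h3
    have := h.M_le _ _ hwv
    rcases KN b w (by omega) (by omega) h4 with rfl | rfl
    · obtain rfl := cx v hwv
      omega
    -- The only case where the attachments of `y` matter: without `yN` the ear could end at `y`
    -- further right.
    · have : b < a := not_le.1 fun h5 => yN b h5 (by omega) h4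
      omega

/-- The three inner vertices fill the room at `a`, `a + 1` and `a + 2`. The ears on either side then
pull the middle vertex `y` apart: the left one forces its level to be at most `a`, the right one at
least `a + 1`. -/
theorem no_three_ear (h : EarSystem N M E l) {a : ℤ} {x y z : V} (ha : -1 ≤ a) (ha' : a ≤ 0)
    (hxz : x ≠ z) (hx : N a x) (hxy : M x y) (hyz : M y z) (hz : N (a + 2) z) : False := by
  have hyx := h.M_symm _ _ hxy
  have hzy := h.M_symm _ _ hyz
  have nxy := h.M_ne _ _ hxy
  have nyz := h.M_ne _ _ hyz
  have Ka : ∀ w, E a w → w = x ∨ w = y := fun w =>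
    h.cap_pair (by omega) (by omega) nxy (h.E_of_N _ _ hx) (h.E_of_M _ _ _ hx hxy)
  have Kb : ∀ w, E (a + 1) w → w = x ∨ w = z := fun w =>
    h.cap_pair (by omega) (by omega) hxz (h.E_of_N_near hx (by omega) (by omega))
      (h.E_of_N_near hz (by omega) (by omega))
  have Kc : ∀ w, E (a + 2) w → w = y ∨ w = z := fun w =>
    h.cap_pair (by omega) (by omega) nyz (h.E_of_M _ _ _ hz hzy) (h.E_of_N _ _ hz)
  have cx : ∀ w, M x w → w = y := fun w hw =>
    (Ka w (h.E_of_M _ _ _ hx hw)).resolve_left (h.M_ne _ _ hw).symm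
  have cz : ∀ w, M z w → w = y := fun w hw =>
    (Kc w (h.E_of_M _ _ _ hz hw)).resolve_right (h.M_ne _ _ hw).symm
  have yN : ∀ c, a ≤ c → c ≤ a + 2 → ¬ N c y := by
    intro c h1 h2 hy
    rcases Kb y (h.E_of_N_near hy (by omega) (by omega)) with rfl | rfl
    exacts [nxy rfl, nyz rfl]
  have h1 := h.level_le_of_ear (j := a - 2) (by omega) (by omega) (Or.inl rfl) hxy Ka cx yN
  -- Reflected, this is the ear over the edge `a + 2`. The edge `a + 3` would be out of range for `a
  -- = 0`.
  have h2 := h.mirror.level_le_of_ear (a := -(a + 2)) (j := -(a + 3)) (by omega) (by omega)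
    (Or.inr (by ring)) hzy (by simpa [or_comm] using Kc) cz
    (fun c h1 h2 => yN (-c) (by omega) (by omega))
  omega

theorem exists_single_ear (h : EarSystem N M E l) :
    ∃ a b z, a ≤ 0 ∧ 1 ≤ b ∧ N a z ∧ N b z := by
  obtain ⟨a, b, ha, hb, hab⟩ := h.ear 0 (by omega) (by omega)
  rcases hab with ⟨z, h1, h2⟩ | ⟨h0, x, y, h1, h2, h3⟩ | ⟨h0, x, y, z, hn, h1, h2, h3, h4⟩
  · exact ⟨a, b, z, ha, hb, h1, h2⟩
  · exact (h.no_two_ear ha hb h0 h1 h2 h3).elim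
  · subst h0
    exact (h.no_three_ear (by omega) ha hn h1 h2 h3 h4).elim

/-- The ear over the edge `-2` when a vertex `z` spans the vertices `-1` and `1`. -/
theorem left_ear_cases (h : EarSystem N M E l) {z : V} (hz : N (-1) z) (hz' : N 1 z) :
    (∃ w, l w ≤ -1 ∧ E 0 w ∧ E (-1) w) ∨ (∃ x, M z x ∧ l x ≤ -1) ∨
      (∃ u x, M z u ∧ M u x ∧ l u = 0 ∧ l x ≤ -1 ∧ N (-2) x) := by
  have lz1 := h.N_le _ _ hz
  have lz2 := h.N_ge _ _ hz'
  obtain ⟨s, t, hs, ht, hst⟩ := h.ear (-2) (by omega) (by omega)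
  have Ez : ∀ c, -2 ≤ c → c ≤ 2 → E c z := fun c h1 h2 => by
    rcases le_or_gt c 0 with h3 | h3
    · exact h.E_of_N_near hz (by omega) (by omega)
    · exact h.E_of_N_near hz' (by omega) (by omega)
  rcases hst with ⟨w, h1, h2⟩ | ⟨h0, x, y, h1, h2, h3⟩ | ⟨h0, x, u, w, hn, h1, h2, h3, h4⟩
  · have := h.N_le _ _ h1
    have := h.N_ge _ _ h2
    exact Or.inl ⟨w, by omega, h.E_of_N_near h2 (by omega) (by omega),
      h.E_of_N_near h2 (by omega) (by omega)⟩
  · have lx := h.N_le _ _ h1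
    have hyx := h.M_symm _ _ h2
    rcases h.cap t (by omega) (by omega) x y z (h.E_of_M _ _ _ h3 hyx) (h.E_of_N _ _ h3)
      (Ez t (by omega) (by omega)) with rfl | rfl | rfl
    · exact (h.M_ne _ _ h2 rfl).elim
    · omega
    · exact Or.inr (Or.inl ⟨x, hyx, by omega⟩)
  · have lx := h.N_le _ _ h1
    have hux := h.M_symm _ _ h2
    have hwu := h.M_symm _ _ h3
    have lu := h.M_le _ _ hux
    rcases h.cap t (by omega) (by omega) u w z (h.E_of_M _ _ _ h4 hwu) (h.E_of_N _ _ h4)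
      (Ez t (by omega) (by omega)) with rfl | rfl | rfl
    · exact (h.M_ne _ _ h3 rfl).elim
    · exact Or.inr (Or.inl ⟨x, hux, by omega⟩)
    · rcases eq_or_ne (l u) 0 with h5 | h5
      · obtain rfl : s = -2 := by omega
        exact Or.inr (Or.inr ⟨u, x, hwu, hux, h5, by omega, h1⟩)
      · exact Or.inr (Or.inl ⟨u, hwu, by omega⟩)

/-- Here `z` has level 0 and is near -1, 0 and 1, leaving room for just one more vertex at each. The
ears over the edges -2 and 1 each demand a vertex of their own there, on opposite sides. -/
theorem false_of_spanning (h : EarSystem N M E l) {z : V} (hz : N (-1) z) (hz' : N 1 z) :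
    False := by
  have lz1 := h.N_le _ _ hz
  have lz2 := h.N_ge _ _ hz'
  have c0 := h.cap 0 (by omega) (by omega)
  have c1 := h.cap 1 (by omega) (by omega)
  have cm := h.cap (-1) (by omega) (by omega)
  have e0 := h.E_of_N_succ 0 z hz'
  have e1 := h.E_of_N _ z hz'
  have em := h.E_of_N _ z hz
  have M1 : ∀ x, M z x → E 1 x := fun x hx => h.E_of_M _ _ _ hz' hx
  have Mm : ∀ x, M z x → E (-1) x := fun x hx => h.E_of_M _ _ _ hz hx
  have nM := h.M_ne
  have n2 := h.E_of_N_succ 1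
  have hl := h.left_ear_cases hz hz'
  have hr := h.mirror.left_ear_cases (z := z) (by simpa using hz') hz
  norm_num at hr
  rcases hl with ⟨w, h1, h2, h3⟩ | ⟨x, h1, h2⟩ | ⟨u, x, h1, h2, h3, h4, h5⟩ <;>
  rcases hr with ⟨w', h1', h2', h3'⟩ | ⟨x', h1', h2'⟩ | ⟨u', x', h1', h2', h3', h4', h5'⟩
  -- Each case yields three distinct vertices near one of -1, 0, 1, told apart by level. When both
  -- sides are of the third kind, the two middle vertices coincide, and the far vertex adjacent to 2
  -- is the third one near 1.
  · grind
  · grind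
  · grind
  · grind
  · grind
  · grind
  · grind
  · grind
  · grind

/-- Both central edges have ears with one inner vertex. If these vertices coincide,
`false_of_spanning` applies. If not, they fill the room at -1, 0 and 1 and are closed under `M`, so
the ear over the edge -3 must start at one of them, which their levels forbid. -/
theorem false_of_earSystem (h : EarSystem N M E l) : False := by
  obtain ⟨a', b', z', ha', hb', hz1', hz2'⟩ := h.exists_single_ear
  obtain ⟨b, a, z, hb, ha, hz2, hz1⟩ := h.mirror.exists_single_ear
  obtain ⟨b, rfl⟩ : ∃ c, b = -c := ⟨-b, by ring⟩
  obtain ⟨a, rfl⟩ : ∃ c, a = -c := ⟨-a, by ring⟩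
  rw [neg_neg] at hz1 hz2
  have := h.N_le _ _ hz1
  have := h.N_ge _ _ hz2
  have := h.N_le _ _ hz1'
  have := h.N_ge _ _ hz2'
  rcases eq_or_ne z z' with rfl | hne
  · obtain rfl : a = -1 := by omega
    obtain rfl : b' = 1 := by omega
    exact h.false_of_spanning hz1 hz2'
  · have K : ∀ i, -1 ≤ i → i ≤ 1 → ∀ w, E i w → w = z ∨ w = z' := by
      intro i h1 h2 w
      refine h.cap_pair (by omega) (by omega) hne ?_ ?_
      · rcases eq_or_ne i (-1) with rfl | h3
        · exact h.E_of_N_near hz1 (by omega) (by omega)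
        · exact h.E_of_N_near hz2 (by omega) (by omega)
      · rcases eq_or_ne i 1 with rfl | h3
        · exact h.E_of_N_near hz2' (by omega) (by omega)
        · exact h.E_of_N_near hz1' (by omega) (by omega)
    obtain ⟨s, t, hs, ht, hsz, htz⟩ := h.ear_in_pair (x := z) (y := z') (i := -3)
      (fun w hw => (K b (by omega) (by omega) w (h.E_of_M _ _ _ hz2 hw)).resolve_left
        (h.M_ne _ _ hw).symm)
      (fun w hw => (K a' (by omega) (by omega) w (h.E_of_M _ _ _ hz1' hw)).resolve_right
        (h.M_ne _ _ hw).symm)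
      (by omega) (by omega) (by
        -- An ear over the edge -3 spans at most three steps, so its right end `d` is in `[-2, 0]`,
        -- next to the capped vertex -1.
        intro c d u w hc hd hcd hu hw
        have := K (-1) (by omega) (by omega) w (h.E_of_N_near hw (by omega) (by omega))
        tauto)
    rcases hsz with hsz | hsz <;>
    · have := h.N_le _ _ hsz
      omega

end EarSystem

/-! ### Edges that are not recognizable lie on short cycles -/

variable {V : Type*}

theorem square_adj_iff {H : SimpleGraph V} {x y : V} :
    (square H).Adj x y ↔ x ≠ y ∧ (H.Adj x y ∨ ∃ w, H.Adj x w ∧ H.Adj w y) := by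
  refine and_congr_right fun hne => ⟨fun h => ?_, ?_⟩
  · have hr : H.Reachable x y := SimpleGraph.reachable_of_edist_ne_top
      (ne_top_of_le_ne_top (by decide) h)
    obtain ⟨w, hw⟩ := hr.exists_walk_length_eq_edist
    rw [← hw] at h
    have h : w.length ≤ 2 := by exact_mod_cast h
    match w, h with
    | .nil, _ => exact absurd rfl hne
    | .cons h1 .nil, _ => exact Or.inl h1
    | .cons h1 (.cons h2 .nil), _ => exact Or.inr ⟨_, h1, h2⟩
  · rintro (h | ⟨w, h1, h2⟩)
    · exact (SimpleGraph.edist_le h.toWalk).trans (by norm_num)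
    · exact (SimpleGraph.edist_le (.cons h1 (.cons h2 .nil))).trans (by norm_num)

theorem square_adj_of_common {H : SimpleGraph V} {x y w : V} (hne : x ≠ y) (h1 : H.Adj x w)
    (h2 : H.Adj w y) : (square H).Adj x y :=
  square_adj_iff.2 ⟨hne, Or.inr ⟨w, h1, h2⟩⟩

/-- The vertices `x, …, y` form a path of length at most five from `u` to `v`. -/
def HasShortPath (K : SimpleGraph V) (u v : V) : Prop :=
  (∃ t, K.Adj u t ∧ K.Adj t v) ∨
  (∃ x y, K.Adj u x ∧ K.Adj x y ∧ K.Adj y v) ∨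
  (∃ x w y, x ≠ y ∧ K.Adj u x ∧ K.Adj x w ∧ K.Adj w y ∧ K.Adj y v) ∨
  (∃ x w z y, x ≠ z ∧ x ≠ y ∧ w ≠ y ∧
    K.Adj u x ∧ K.Adj x w ∧ K.Adj w z ∧ K.Adj z y ∧ K.Adj y v)

/-- The candidate partition consists of the other `H`-neighbours of `u` and of `v`. Any failure of a
recognizability condition closes a cycle of length 3 to 6 through `uv`; `a` and `b` only make the
two parts nonempty. -/
theorem hasShortPath_of_not_isRecognizableEdge {H : SimpleGraph V} {u v a b : V}
    (huv : H.Adj u v) (ha : H.Adj u a) (hav : a ≠ v) (hb : H.Adj v b) (hbu : b ≠ u)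
    (h : ¬ IsRecognizableEdge (square H) u v) :
    HasShortPath (H.deleteEdges {s(u, v)}) u v := by
  by_contra hs
  simp only [HasShortPath, SimpleGraph.deleteEdges_adj, Set.mem_singleton_iff, Sym2.eq_iff,
    not_or, not_exists] at hs
  obtain ⟨s3, s4, s5, s6⟩ := hs
  have hne := huv.ne
  have c3 : ∀ t, H.Adj u t → H.Adj t v → False := fun t h1 h2 =>
    s3 t (by have := h1.ne; have := h2.ne; tauto)
  have c4 : ∀ x y, x ≠ v → y ≠ u → H.Adj u x → H.Adj x y → H.Adj y v → False :=
    fun x y n1 n2 h1 h2 h3 => s4 x y (by have := h1.ne; have := h3.ne; tauto)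
  have c5 : ∀ x w y, x ≠ v → y ≠ u → w ≠ u → w ≠ v →
      H.Adj u x → H.Adj x w → H.Adj w y → H.Adj y v → False := by
    intro x w y n1 n2 n3 n4 h1 h2 h3 h4
    refine s5 x w y ⟨?_, ?_⟩
    · rintro rfl; exact c3 x h1 h4
    · have := h1.ne; have := h4.ne; tauto
  have c6 : ∀ x w z y, x ≠ v → y ≠ u → w ≠ u → w ≠ v → z ≠ u → z ≠ v → w ≠ y →
      H.Adj u x → H.Adj x w → H.Adj w z → H.Adj z y → H.Adj y v → False := by
    intro x w z y n1 n2 n3 n4 n5 n6 n7 h1 h2 h3 h4 h5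
    refine s6 x w z y ⟨?_, ?_, n7, ?_⟩
    · rintro rfl; exact c4 x y n1 n2 h1 h4 h5
    · rintro rfl; exact c3 x h1 h5
    · have := h1.ne; have := h5.ne; tauto
  have sq : ∀ {x y}, (square H).Adj x y → x ≠ y ∧ (H.Adj x y ∨ ∃ w, H.Adj x w ∧ H.Adj w y) :=
    fun hxy => square_adj_iff.1 hxy
  refine h ⟨square_adj_iff.2 ⟨hne, Or.inl huv⟩, {x | H.Adj u x ∧ x ≠ v}, {y | H.Adj v y ∧ y ≠ u}, ?_⟩
  have key : ∀ w, (square H).Adj u w → ¬ H.Adj u w → ¬ H.Adj v w →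
      ∃ x, H.Adj u x ∧ x ≠ v ∧ H.Adj x w := by
    intro w h1 h2 h3
    obtain ⟨-, h4 | ⟨x, h4, h5⟩⟩ := sq h1
    · exact (h2 h4).elim
    · exact ⟨x, h4, fun h => h3 (h ▸ h5), h5⟩
  have key' : ∀ w, (square H).Adj v w → ¬ H.Adj u w → ¬ H.Adj v w →
      ∃ y, H.Adj v y ∧ y ≠ u ∧ H.Adj y w := by
    intro w h1 h2 h3
    obtain ⟨-, h4 | ⟨x, h4, h5⟩⟩ := sq h1
    · exact (h3 h4).elim
    · exact ⟨x, h4, fun h => h2 (h ▸ h5), h5⟩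
  -- Here `w` is at distance two from `u`, through `x`. Being within distance two of `y` as well
  -- would close a cycle of length 5 or 6.
  have hcross : ∀ w x y, w ≠ u → w ≠ v → ¬ H.Adj u w → ¬ H.Adj v w → H.Adj u x → x ≠ v →
      H.Adj x w → H.Adj v y → y ≠ u → ¬ (square H).Adj w y := by
    intro w x y n1 n2 n3 n4 h1 h2 h3 h4 h5 h6
    obtain ⟨n5, h6 | ⟨z, h6, h7⟩⟩ := sq h6
    · exact c5 x w y h2 h5 n1 n2 h1 h3 h6 h4.symm
    · have n6 : z ≠ u := by rintro rfl; exact n3 h6.symm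
      have n7 : z ≠ v := by rintro rfl; exact n4 h6.symm
      exact c6 x w z y h2 h5 n1 n2 n6 n7 n5 h1 h3 h6 h7 h4.symm
  have hcross' : ∀ w x y, w ≠ u → w ≠ v → ¬ H.Adj u w → ¬ H.Adj v w → H.Adj v y → y ≠ u →
      H.Adj y w → H.Adj u x → x ≠ v → ¬ (square H).Adj w x := by
    intro w x y n1 n2 n3 n4 h1 h2 h3 h4 h5 h6
    obtain ⟨n5, h6 | ⟨z, h6, h7⟩⟩ := sq h6
    · exact c5 x w y h5 h2 n1 n2 h4 h6.symm h3.symm h1.symm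
    · have n6 : z ≠ u := by rintro rfl; exact n3 h6.symm
      have n7 : z ≠ v := by rintro rfl; exact n4 h6.symm
      refine c6 x z w y h5 h2 n6 n7 n1 n2 ?_ h4 h7.symm h6.symm h3.symm h1.symm
      rintro rfl
      exact c4 x z h5 h2 h4 h7.symm h1.symm
  constructor
  · ext w
    simp only [Set.mem_union, Set.mem_ofPred_eq, Set.mem_inter_iff, SimpleGraph.mem_neighborSet]
    constructor
    · rintro (⟨h1, h2⟩ | ⟨h1, h2⟩)
      · exact ⟨square_adj_iff.2 ⟨h1.ne, Or.inl h1⟩, square_adj_of_common h2.symm huv.symm h1⟩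
      · exact ⟨square_adj_of_common h2.symm huv h1, square_adj_iff.2 ⟨h1.ne, Or.inl h1⟩⟩
    · rintro ⟨h1, h2⟩
      by_contra hc
      have n1 := h1.ne.symm
      have n2 := h2.ne.symm
      have n3 : ¬ H.Adj u w := by tauto
      have n4 : ¬ H.Adj v w := by tauto
      obtain ⟨x, hx1, hx2, hx3⟩ := key w h1 n3 n4
      obtain ⟨y, hy1, hy2, hy3⟩ := key' w h2 n3 n4
      exact c5 x w y hx2 hy2 n1 n2 hx1 hx3 hy3.symm hy1.symm
  · rw [Set.disjoint_left]
    rintro x ⟨h1, -⟩ ⟨h2, -⟩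
    exact c3 x h1 h2.symm
  · exact ⟨a, ha, hav⟩
  · exact ⟨b, hb, hbu⟩
  · rintro x ⟨h1, -⟩ y ⟨h2, -⟩ hxy
    exact square_adj_of_common hxy h1.symm h2
  · rintro x ⟨h1, -⟩ y ⟨h2, -⟩ hxy
    exact square_adj_of_common hxy h1.symm h2
  · rintro x ⟨h1, h2⟩ y ⟨h3, h4⟩ h5
    obtain ⟨-, h5 | ⟨z, h5, h6⟩⟩ := sq h5
    · exact c4 x y h2 h4 h1 h5 h3.symm
    · rcases eq_or_ne z u with rfl | h7
      · exact c3 y h6 h3.symm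
      rcases eq_or_ne z v with rfl | h8
      · exact c3 x h1 h5
      exact c5 x z y h2 h4 h7 h8 h1 h5 h6 h3.symm
  · rintro w ⟨h1, h2⟩ y ⟨h3, h4⟩
    simp only [SimpleGraph.mem_neighborSet] at h1
    simp only [Set.mem_union, Set.mem_ofPred_eq, Set.mem_singleton_iff] at h2
    have n1 := h1.ne.symm
    have n2 : w ≠ v := by tauto
    have n3 : ¬ H.Adj u w := by tauto
    have n4 : ¬ H.Adj v w := by tauto
    obtain ⟨x, hx1, hx2, hx3⟩ := key w h1 n3 n4
    exact hcross w x y n1 n2 n3 n4 hx1 hx2 hx3 h3 h4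
  · rintro w ⟨h1, h2⟩ x ⟨h3, h4⟩
    simp only [SimpleGraph.mem_neighborSet] at h1
    simp only [Set.mem_union, Set.mem_ofPred_eq, Set.mem_singleton_iff] at h2
    have n1 := h1.ne.symm
    have n2 : w ≠ u := by tauto
    have n3 : ¬ H.Adj u w := by tauto
    have n4 : ¬ H.Adj v w := by tauto
    obtain ⟨y, hy1, hy2, hy3⟩ := key' w h1 n3 n4
    exact hcross' w x y n2 n1 n3 n4 hy1 hy2 hy3 h3 h4
  · rintro w ⟨h1, h2⟩
    simp only [SimpleGraph.mem_neighborSet] at h1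
    simp only [Set.mem_union, Set.mem_ofPred_eq, Set.mem_singleton_iff] at h2
    have n2 : w ≠ v := by tauto
    have n1 := h1.ne.symm
    obtain ⟨x, hx1, hx2, hx3⟩ := key w h1 (by tauto) (by tauto)
    exact ⟨x, ⟨hx1, hx2⟩, square_adj_iff.2 ⟨hx3.ne.symm, Or.inl hx3.symm⟩⟩
  · rintro w ⟨h1, h2⟩
    simp only [SimpleGraph.mem_neighborSet] at h1
    simp only [Set.mem_union, Set.mem_ofPred_eq, Set.mem_singleton_iff] at h2
    have n2 : w ≠ u := by tauto
    have n1 := h1.ne.symm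
    obtain ⟨y, hy1, hy2, hy3⟩ := key' w h1 (by tauto) (by tauto)
    exact ⟨y, ⟨hy1, hy2⟩, square_adj_iff.2 ⟨hy3.ne.symm, Or.inl hy3.symm⟩⟩

/-! ### A geodesic of length eight carries an ear system -/

/-- `p (-4), …, p 4` is a geodesic path of `H`, as witnessed by the level function `l`. -/
structure IsGeodesic (H : SimpleGraph V) (p : ℤ → V) (l : V → ℤ) : Prop where
  level_le : ∀ x y, H.Adj x y → l x ≤ l y + 1
  level : ∀ i, -4 ≤ i → i ≤ 4 → l (p i) = i
  adj : ∀ i, -4 ≤ i → i ≤ 3 → H.Adj (p i) (p (i + 1))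

/-- `x` is not one of the path vertices. -/
def OffPath (p : ℤ → V) (x : V) : Prop :=
  ∀ i, -4 ≤ i → i ≤ 4 → x ≠ p i

/-- `x` is off the path and adjacent to `p a`. -/
def OffAdj (H : SimpleGraph V) (p : ℤ → V) (a : ℤ) (x : V) : Prop :=
  -4 ≤ a ∧ a ≤ 4 ∧ OffPath p x ∧ H.Adj (p a) x

/-- `x` and `y` are off the path and adjacent. -/
def OffEdge (H : SimpleGraph V) (p : ℤ → V) (x y : V) : Prop :=
  OffPath p x ∧ OffPath p y ∧ H.Adj x y

/-- `x` is off the path and at distance at most two from `p a`, if `a` is an index of the path. -/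
def OffNear (H : SimpleGraph V) (p : ℤ → V) (a : ℤ) (x : V) : Prop :=
  OffPath p x ∧ (-4 ≤ a → a ≤ 4 → (square H).Adj (p a) x)

namespace IsGeodesic

variable {H : SimpleGraph V} {p : ℤ → V} {l : V → ℤ}

theorem near_of_adj {a : ℤ} {x : V} (hx : OffAdj H p a x) : OffNear H p a x :=
  ⟨hx.2.2.1, fun _ _ => square_adj_iff.2 ⟨hx.2.2.2.ne, Or.inl hx.2.2.2⟩⟩

theorem near_of_adj_succ (h : IsGeodesic H p l) {a : ℤ} {x : V} (hx : OffAdj H p (a + 1) x) :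
    OffNear H p a x :=
  ⟨hx.2.2.1, fun h1 h2 => square_adj_of_common (hx.2.2.1 a h1 h2).symm
    (h.adj a h1 (by have := hx.2.1; omega)) hx.2.2.2⟩

theorem near_of_adj_pred (h : IsGeodesic H p l) {a : ℤ} {x : V} (hx : OffAdj H p (a - 1) x) :
    OffNear H p a x :=
  ⟨hx.2.2.1, fun h1 h2 => square_adj_of_common (hx.2.2.1 a h1 h2).symm
    (by simpa using (h.adj (a - 1) hx.1 (by omega)).symm) hx.2.2.2⟩

theorem near_of_edge {a : ℤ} {x y : V} (hx : OffAdj H p a x) (hxy : OffEdge H p x y) :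
    OffNear H p a y :=
  ⟨hxy.2.1, fun h1 h2 => square_adj_of_common (hxy.2.1 a h1 h2).symm hx.2.2.2 hxy.2.2⟩

/-- The path vertices `i ± 1` and `i ± 2` exist for these `i` and use up four of the six neighbours
in the square. -/
theorem cap (h : IsGeodesic H p l)
    (hcap : ∀ v, ∀ s : Finset V, (∀ x ∈ s, (square H).Adj v x) → s.card ≤ 6)
    (i : ℤ) (hi : -2 ≤ i) (hi' : i ≤ 2) (x y z : V) (hx : OffNear H p i x) (hy : OffNear H p i y)
    (hz : OffNear H p i z) : x = y ∨ x = z ∨ y = z := by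
  classical
  by_contra! hc
  obtain ⟨n1, n2, n3⟩ := hc
  have inj : ∀ a b, -4 ≤ a → a ≤ 4 → -4 ≤ b → b ≤ 4 → a ≠ b → p a ≠ p b := by
    intro a b h1 h2 h3 h4 hne heq
    have e1 := h.level a h1 h2
    have e2 := h.level b h3 h4
    rw [heq] at e1
    omega
  have a1 := h.adj (i - 2) (by omega) (by omega)
  have a2 := h.adj (i - 1) (by omega) (by omega)
  have a3 := h.adj i (by omega) (by omega)
  have a4 := h.adj (i + 1) (by omega) (by omega)
  rw [show i - 2 + 1 = i - 1 by ring] at a1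
  rw [show i - 1 + 1 = i by ring] at a2
  rw [show i + 1 + 1 = i + 2 by ring] at a4
  have b1 : (square H).Adj (p i) (p (i - 2)) := square_adj_of_common
    (inj _ _ (by omega) (by omega) (by omega) (by omega) (by omega)) a2.symm a1.symm
  have b2 : (square H).Adj (p i) (p (i + 2)) := square_adj_of_common
    (inj _ _ (by omega) (by omega) (by omega) (by omega) (by omega)) a3 a4
  have b3 : (square H).Adj (p i) (p (i - 1)) := square_adj_iff.2 ⟨a2.ne.symm, Or.inl a2.symm⟩
  have b4 : (square H).Adj (p i) (p (i + 1)) := square_adj_iff.2 ⟨a3.ne, Or.inl a3⟩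
  have := hcap (p i) {x, y, z, p (i - 2), p (i - 1), p (i + 1), p (i + 2)} (by
    intro w hw
    simp only [Finset.mem_insert, Finset.mem_singleton] at hw
    rcases hw with rfl | rfl | rfl | rfl | rfl | rfl | rfl
    exacts [hx.2 (by omega) (by omega), hy.2 (by omega) (by omega), hz.2 (by omega) (by omega),
      b1, b3, b4, b2])
  have ox := fun j h1 h2 => hx.1 j h1 h2
  have oy := fun j h1 h2 => hy.1 j h1 h2
  have oz := fun j h1 h2 => hz.1 j h1 h2
  rw [Finset.card_insert_of_notMem, Finset.card_insert_of_notMem, Finset.card_insert_of_notMem,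
    Finset.card_insert_of_notMem, Finset.card_insert_of_notMem, Finset.card_insert_of_notMem,
    Finset.card_singleton] at this
  · omega
  all_goals simp only [Finset.mem_insert, Finset.mem_singleton, not_or]
  · exact inj _ _ (by omega) (by omega) (by omega) (by omega) (by omega)
  · constructor <;> exact inj _ _ (by omega) (by omega) (by omega) (by omega) (by omega)
  · refine ⟨?_, ?_, ?_⟩ <;> exact inj _ _ (by omega) (by omega) (by omega) (by omega) (by omega)
  · refine ⟨?_, ?_, ?_, ?_⟩ <;> exact oz _ (by omega) (by omega)
  · refine ⟨n3, ?_, ?_, ?_, ?_⟩ <;> exact oy _ (by omega) (by omega)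
  · refine ⟨n1, n2, ?_, ?_, ?_, ?_⟩ <;> exact ox _ (by omega) (by omega)

section Ears

variable {i : ℤ}

/-- A vertex is off the path, or on it to the left or to the right of the edge from `i` to
`i + 1`. -/
theorem off_or (p : ℤ → V) (i : ℤ) (x : V) :
    OffPath p x ∨ (∃ c, -4 ≤ c ∧ c ≤ i ∧ c ≤ 4 ∧ x = p c) ∨
      (∃ c, -4 ≤ c ∧ i + 1 ≤ c ∧ c ≤ 4 ∧ x = p c) := by
  by_cases hx : OffPath p x
  · exact Or.inl hx
  · unfold OffPath at hx
    push Not at hx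
    obtain ⟨c, h1, h2, rfl⟩ := hx
    rcases le_or_gt c i with h3 | h3
    · exact Or.inr (Or.inl ⟨c, h1, h3, h2, rfl⟩)
    · exact Or.inr (Or.inr ⟨c, h1, h3, h2, rfl⟩)

theorem index_le (h : IsGeodesic H p l) {c : ℤ} (h1 : -4 ≤ c) (h2 : c ≤ 4) {x : V}
    (hx : H.Adj (p c) x) : c ≤ l x + 1 ∧ l x ≤ c + 1 := by
  have := h.level_le _ _ hx
  have := h.level_le _ _ hx.symm
  have := h.level c h1 h2
  omega

/-- Only the edge from `p i` to `p (i + 1)` joins the two sides of the path. -/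
theorem not_adj_across (h : IsGeodesic H p l) {a b : ℤ} (ha : -4 ≤ a) (ha' : a ≤ i)
    (hb : i + 1 ≤ b) (hb' : b ≤ 4) :
    ¬ (H.deleteEdges {s(p i, p (i + 1))}).Adj (p a) (p b) := by
  intro hab
  rw [SimpleGraph.deleteEdges_adj] at hab
  have h1 := h.index_le ha (by omega) hab.1
  rw [h.level b (by omega) hb'] at h1
  obtain rfl : a = i := by omega
  obtain rfl : b = a + 1 := by omega
  exact hab.2 rfl

/-- As only the deleted edge crosses between the two sides, an inner vertex on the path would make
one of the two steps impossible. For longer paths, an inner vertex on the geodesic similarly lets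
one pass to a shorter path that still crosses the edge. -/
theorem ear_of_two (h : IsGeodesic H p l) {a b : ℤ} {t : V} (ha : -4 ≤ a) (ha' : a ≤ i)
    (hb : i + 1 ≤ b) (hb' : b ≤ 4)
    (h1 : (H.deleteEdges {s(p i, p (i + 1))}).Adj (p a) t)
    (h2 : (H.deleteEdges {s(p i, p (i + 1))}).Adj t (p b)) :
    HasEar (OffAdj H p) (OffEdge H p) i := by
  rcases off_or p i t with ht | ⟨c, c1, c2, c3, rfl⟩ | ⟨c, c1, c2, c3, rfl⟩
  · exact ⟨a, b, ha', hb, Or.inl ⟨t, ⟨ha, by omega, ht, h1.1⟩, ⟨by omega, hb', ht, h2.1.symm⟩⟩⟩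
  · exact (h.not_adj_across c1 c2 hb hb' h2).elim
  · exact (h.not_adj_across ha ha' c2 c3 h1).elim

theorem ear_of_three (h : IsGeodesic H p l) {a b : ℤ} {x y : V} (ha : -4 ≤ a) (ha' : a ≤ i)
    (hb : i + 1 ≤ b) (hb' : b ≤ 4) (hab : b ≤ a + 3)
    (h1 : (H.deleteEdges {s(p i, p (i + 1))}).Adj (p a) x)
    (h2 : (H.deleteEdges {s(p i, p (i + 1))}).Adj x y)
    (h3 : (H.deleteEdges {s(p i, p (i + 1))}).Adj y (p b)) :
    HasEar (OffAdj H p) (OffEdge H p) i := by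
  rcases off_or p i x with hx | ⟨c, c1, c2, c3, rfl⟩ | ⟨c, c1, c2, c3, rfl⟩
  · rcases off_or p i y with hy | ⟨c, c1, c2, c3, rfl⟩ | ⟨c, c1, c2, c3, rfl⟩
    · exact ⟨a, b, ha', hb, Or.inr (Or.inl ⟨hab, x, y, ⟨ha, by omega, hx, h1.1⟩, ⟨hx, hy, h2.1⟩,
        ⟨by omega, hb', hy, h3.1.symm⟩⟩)⟩
    · exact (h.not_adj_across c1 c2 hb hb' h3).elim
    · exact h.ear_of_two ha ha' c2 c3 h1 h2
  · exact h.ear_of_two c1 c2 hb hb' h2 h3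
  · exact (h.not_adj_across ha ha' c2 c3 h1).elim

theorem ear_of_four (h : IsGeodesic H p l)
    (hcap : ∀ v, ∀ s : Finset V, (∀ x ∈ s, (square H).Adj v x) → s.card ≤ 6)
    (hi : -3 ≤ i) (hi' : i ≤ 2) {a b : ℤ} {x w y : V} (ha : -4 ≤ a) (ha' : a ≤ i)
    (hb : i + 1 ≤ b) (hb' : b ≤ 4) (hab : b ≤ a + 2) (hxy : x ≠ y)
    (h1 : (H.deleteEdges {s(p i, p (i + 1))}).Adj (p a) x)
    (h2 : (H.deleteEdges {s(p i, p (i + 1))}).Adj x w)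
    (h3 : (H.deleteEdges {s(p i, p (i + 1))}).Adj w y)
    (h4 : (H.deleteEdges {s(p i, p (i + 1))}).Adj y (p b)) :
    HasEar (OffAdj H p) (OffEdge H p) i := by
  rcases off_or p i x with hx | ⟨c, c1, c2, c3, rfl⟩ | ⟨c, c1, c2, c3, rfl⟩
  · rcases off_or p i w with hw | ⟨c, c1, c2, c3, rfl⟩ | ⟨c, c1, c2, c3, rfl⟩
    · rcases off_or p i y with hy | ⟨c, c1, c2, c3, rfl⟩ | ⟨c, c1, c2, c3, rfl⟩
      · have nx : OffAdj H p a x := ⟨ha, by omega, hx, h1.1⟩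
        have ny : OffAdj H p b y := ⟨by omega, hb', hy, h4.1.symm⟩
        rcases eq_or_ne b (a + 2) with hd | hd
        · exact ⟨a, b, ha', hb, Or.inr (Or.inr ⟨hd, x, w, y, hxy, nx, ⟨hx, hw, h2.1⟩,
            ⟨hw, hy, h3.1⟩, ny⟩)⟩
        -- Three inner vertices over a single edge are all near both of its ends, against the cap;
        -- at least one end has index in `[-2, 2]`.
        · obtain rfl : a = i := by omega
          obtain rfl : b = a + 1 := by omega
          exfalso
          have nw : x ≠ w ∧ w ≠ y := ⟨h2.1.ne, h3.1.ne⟩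
          rcases le_or_gt (-2) a with h5 | h5
          · have := h.cap hcap a h5 hi' x w y (near_of_adj nx) (near_of_edge nx ⟨hx, hw, h2.1⟩)
              (h.near_of_adj_succ ny)
            tauto
          · have := h.cap hcap (a + 1) (by omega) (by omega) x w y
              (h.near_of_adj_pred (by simpa using nx))
              (near_of_edge ny ⟨hy, hw, h3.1.symm⟩) (near_of_adj ny)
            tauto
      · exact (h.not_adj_across c1 c2 hb hb' h4).elim
      · have e1 := h.index_le c1 c3 h4.1
        rw [h.level b (by omega) hb'] at e1
        exact h.ear_of_three ha ha' c2 c3 (by omega) h1 h2 h3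
    · exact h.ear_of_two c1 c2 hb hb' h3 h4
    · exact h.ear_of_two ha ha' c2 c3 h1 h2
  · have e1 := h.index_le ha (by omega) h1.1
    rw [h.level c c1 c3] at e1
    exact h.ear_of_three c1 c2 hb hb' (by omega) h2 h3 h4
  · exact (h.not_adj_across ha ha' c2 c3 h1).elim

theorem ear_of_hasShortPath (h : IsGeodesic H p l)
    (hcap : ∀ v, ∀ s : Finset V, (∀ x ∈ s, (square H).Adj v x) → s.card ≤ 6)
    (hi : -3 ≤ i) (hi' : i ≤ 2)
    (hs : HasShortPath (H.deleteEdges {s(p i, p (i + 1))}) (p i) (p (i + 1))) :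
    HasEar (OffAdj H p) (OffEdge H p) i := by
  rcases hs with ⟨t, h1, h2⟩ | ⟨x, y, h1, h2, h3⟩ | ⟨x, w, y, n, h1, h2, h3, h4⟩ |
    ⟨x, w, z, y, n1, n2, n3, h1, h2, h3, h4, h5⟩
  · exact h.ear_of_two (by omega) le_rfl le_rfl (by omega) h1 h2
  · exact h.ear_of_three (by omega) le_rfl le_rfl (by omega) (by omega) h1 h2 h3
  · exact h.ear_of_four hcap hi hi' (by omega) le_rfl le_rfl (by omega) (by omega) n h1 h2 h3 h4
  · have ha : -4 ≤ i := by omega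
    have hb : i + 1 ≤ 4 := by omega
    have l0 := h.level i ha (by omega)
    have l1 := h.level (i + 1) (by omega) hb
    rcases off_or p i x with hx | ⟨c, c1, c2, c3, rfl⟩ | ⟨c, c1, c2, c3, rfl⟩
    · rcases off_or p i y with hy | ⟨c, c1, c2, c3, rfl⟩ | ⟨c, c1, c2, c3, rfl⟩
      · have ex := h.index_le ha (by omega) h1.1
        have ey := h.index_le (by omega) hb h5.1.symm
        rcases off_or p i w with hw | ⟨c, c1, c2, c3, rfl⟩ | ⟨c, c1, c2, c3, rfl⟩
        · rcases off_or p i z with hz | ⟨c, c1, c2, c3, rfl⟩ | ⟨c, c1, c2, c3, rfl⟩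
          -- Four inner vertices off the path: `x`, `w`, `y` crowd the left end and `x`, `z`, `y`
          -- the right end, so whichever end is capped gives a contradiction.
          · exfalso
            have nx : OffAdj H p i x := ⟨ha, by omega, hx, h1.1⟩
            have ny : OffAdj H p (i + 1) y := ⟨by omega, hb, hy, h5.1.symm⟩
            have m1 : x ≠ w ∧ z ≠ y := ⟨h2.1.ne, h4.1.ne⟩
            rcases le_or_gt (-2) i with h6 | h6
            · have := h.cap hcap i h6 hi' x w y (near_of_adj nx)
                (near_of_edge nx ⟨hx, hw, h2.1⟩) (h.near_of_adj_succ ny)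
              tauto
            · have := h.cap hcap (i + 1) (by omega) (by omega) x z y
                (h.near_of_adj_pred (by simpa using nx))
                (near_of_edge ny ⟨hy, hz, h4.1.symm⟩) (near_of_adj ny)
              tauto
          · exact h.ear_of_two c1 c2 le_rfl hb h4 h5
          · have e1 := h.index_le c1 c3 h4.1
            exact h.ear_of_three ha le_rfl c2 c3 (by omega) h1 h2 h3
        · have e1 := h.index_le c1 c3 h2.1.symm
          exact h.ear_of_three c1 c2 le_rfl hb (by omega) h3 h4 h5
        · exact h.ear_of_two ha le_rfl c2 c3 h1 h2
      · exact (h.not_adj_across c1 c2 le_rfl hb h5).elim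
      · have e1 := h.index_le c1 c3 h5.1
        exact h.ear_of_four hcap hi hi' ha le_rfl c2 c3 (by omega) n1 h1 h2 h3 h4
    · have e1 := h.index_le c1 c3 h1.1.symm
      exact h.ear_of_four hcap hi hi' c1 c2 le_rfl hb (by omega) n3 h2 h3 h4 h5
    · exact (h.not_adj_across ha le_rfl c2 c3 h1).elim

end Ears

theorem false_of_not_isRecognizableEdge (h : IsGeodesic H p l)
    (hcap : ∀ v, ∀ s : Finset V, (∀ x ∈ s, (square H).Adj v x) → s.card ≤ 6)
    (hrec : ∀ u v, ¬ IsRecognizableEdge (square H) u v) : False := by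
  refine EarSystem.false_of_earSystem (N := OffAdj H p) (M := OffEdge H p) (E := OffNear H p)
    (l := l) ⟨?_, ?_, ?_, ?_, ?_, ?_, ?_, ?_, ?_, ?_, ?_⟩
  · exact fun a x hx => (h.index_le hx.1 hx.2.1 hx.2.2.2).2
  · intro a x hx
    have := h.index_le hx.1 hx.2.1 hx.2.2.2
    omega
  · exact fun x y hxy => ⟨hxy.2.1, hxy.1, hxy.2.2.symm⟩
  · exact fun x y hxy => hxy.2.2.ne
  · exact fun x y hxy => h.level_le _ _ hxy.2.2
  · exact fun a x hx => near_of_adj hx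
  · exact fun a x hx => h.near_of_adj_succ hx
  · exact fun a x hx => h.near_of_adj_pred hx
  · exact fun a x y hx hxy => near_of_edge hx hxy
  · exact h.cap hcap
  -- The path continues beyond both ends of such an edge; its vertices `i - 1` and `i + 2` are the
  -- further neighbours required.
  · intro i hi hi'
    have a1 := h.adj (i - 1) (by omega) (by omega)
    rw [show i - 1 + 1 = i by ring] at a1
    refine h.ear_of_hasShortPath hcap hi hi' (hasShortPath_of_not_isRecognizableEdge
      (h.adj i (by omega) (by omega)) a1.symm ?_ (h.adj (i + 1) (by omega) (by omega)) ?_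
      (hrec _ _)) <;>
    · intro heq
      have := congrArg l heq
      rw [h.level _ (by omega) (by omega), h.level _ (by omega) (by omega)] at this
      omega

end IsGeodesic

/-! ### Distances in the root and counting by levels -/

variable {H : SimpleGraph V}

theorem connected_of_connected_square (h : (square H).Connected) : H.Connected := by
  have := h.nonempty
  refine ⟨fun x y => ?_⟩
  obtain ⟨w⟩ := h.preconnected x y
  induction w with
  | nil => rfl
  | cons hxy _ ih =>
    refine SimpleGraph.Reachable.trans ?_ ih
    obtain ⟨-, h1 | ⟨w, h1, h2⟩⟩ := square_adj_iff.1 hxy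
    · exact h1.reachable
    · exact h1.reachable.trans h2.reachable

theorem square_adj_of_dist (hc : H.Connected) {x y : V} (h1 : x ≠ y) (h2 : H.dist x y ≤ 2) :
    (square H).Adj x y := by
  refine ⟨h1, ?_⟩
  rw [← (hc x y).coe_dist_eq_edist]
  exact_mod_cast h2

theorem dist_getVert {r x : V} (w : H.Walk r x) (hw : w.length = H.dist r x) {k : ℕ}
    (hk : k ≤ w.length) :
    H.dist r (w.getVert k) = k ∧ H.dist (w.getVert k) x = w.length - k := by
  have h1 := SimpleGraph.dist_le (w.take k)
  have h2 := SimpleGraph.dist_le (w.drop k)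
  rw [SimpleGraph.Walk.take_length] at h1
  rw [SimpleGraph.Walk.drop_length] at h2
  have h3 := (w.take k).reachable.dist_triangle_left x
  omega

theorem exists_between (hc : H.Connected) {r x : V} {j k : ℕ} (h : H.dist r x = j + k) :
    ∃ u, H.dist r u = j ∧ H.dist u x = k := by
  obtain ⟨w, hw⟩ := hc.exists_walk_length_eq_dist r x
  have := dist_getVert w hw (k := j) (by omega)
  exact ⟨w.getVert j, this.1, by omega⟩

theorem dist_le_seven (hc : H.Connected)
    (hcap : ∀ v, ∀ s : Finset V, (∀ x ∈ s, (square H).Adj v x) → s.card ≤ 6)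
    (hrec : ∀ u v, ¬ IsRecognizableEdge (square H) u v) (r x : V) : H.dist r x ≤ 7 := by
  by_contra! h
  obtain ⟨w, hw⟩ := hc.exists_walk_length_eq_dist r x
  refine IsGeodesic.false_of_not_isRecognizableEdge (H := H)
    -- The first nine vertices of a shortest walk, centred by shifting indices and distances by 4.
    (p := fun i => w.getVert (i + 4).toNat) (l := fun y => H.dist r y - 4) ⟨?_, ?_, ?_⟩ hcap hrec
  · intro y z hyz
    have h1 := hc.dist_triangle (u := r) (v := z) (w := y)
    have h2 := SimpleGraph.dist_eq_one_iff_adj.2 hyz.symm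
    omega
  · intro i h1 h2
    have := (dist_getVert w hw (k := (i + 4).toNat) (by omega)).1
    simp only [this]
    omega
  · intro i h1 h2
    have := w.adj_getVert_succ (i := (i + 4).toNat) (by omega)
    simpa only [show (i + 1 + 4).toNat = (i + 4).toNat + 1 by omega] using this

/-- A shortest path from `r` supplies `min j 2` neighbours of `u` in the square on lower levels, and
these take up part of the degree. -/
theorem card_forward_le (hc : H.Connected)
    (hcap : ∀ v, ∀ s : Finset V, (∀ x ∈ s, (square H).Adj v x) → s.card ≤ 6) {r u : V} {j : ℕ}
    (hu : H.dist r u = j) {s : Finset V} (hs : ∀ x ∈ s, (square H).Adj u x ∧ j < H.dist r x) :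
    s.card + min j 2 ≤ 6 := by
  classical
  have anc : ∀ k, 1 ≤ k → k ≤ 2 → k ≤ j → ∃ a, H.dist r a = j - k ∧ (square H).Adj u a := by
    intro k h1 h2 h3
    obtain ⟨a, ha1, ha2⟩ := exists_between hc (r := r) (x := u) (j := j - k) (k := k) (by omega)
    refine ⟨a, ha1, (square_adj_of_dist hc ?_ (by omega)).symm⟩
    rintro rfl
    omega
  rcases Nat.lt_or_ge j 1 with h0 | h0
  · have := hcap u s fun x hx => (hs x hx).1
    omega
  obtain ⟨a, ha1, ha2⟩ := anc 1 le_rfl (by omega) h0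
  have ha : a ∉ s := fun h => by have := (hs a h).2; omega
  rcases Nat.lt_or_ge j 2 with h1 | h1
  · have := hcap u (insert a s) (by
      simp only [Finset.mem_insert, forall_eq_or_imp]
      exact ⟨ha2, fun x hx => (hs x hx).1⟩)
    rw [Finset.card_insert_of_notMem ha] at this
    omega
  obtain ⟨b, hb1, hb2⟩ := anc 2 (by omega) le_rfl h1
  have hb : b ∉ insert a s := by
    rw [Finset.mem_insert, not_or]
    exact ⟨fun h => by subst h; omega, fun h => by have := (hs b h).2; omega⟩
  have := hcap u (insert b (insert a s)) (by
    simp only [Finset.mem_insert, forall_eq_or_imp]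
    exact ⟨hb2, ha2, fun x hx => (hs x hx).1⟩)
  rw [Finset.card_insert_of_notMem hb, Finset.card_insert_of_notMem ha] at this
  omega

/-- The vertices at distance `j` from `r`. -/
noncomputable def level [Fintype V] (H : SimpleGraph V) (r : V) (j : ℕ) : Finset V :=
  {x | H.dist r x = j}

variable [Fintype V]

theorem mem_level {r x : V} {j : ℕ} : x ∈ level H r j ↔ H.dist r x = j := by
  simp [level]

theorem card_level_zero (hc : H.Connected) (r : V) : (level H r 0).card = 1 := by
  rw [Finset.card_eq_one]
  refine ⟨r, ?_⟩
  ext x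
  rw [mem_level, Finset.mem_singleton, hc.dist_eq_zero_iff, eq_comm]

/-- A vertex one or two levels beyond `j` is adjacent in the square to its ancestor on level `j`, so
the forward neighbourhoods of that level cover both next levels. -/
theorem card_level_add_le (hc : H.Connected) (r : V) (j m : ℕ)
    (hm : ∀ u, H.dist r u = j → ∀ s : Finset V,
      (∀ x ∈ s, (square H).Adj u x ∧ j < H.dist r x) → s.card ≤ m) :
    (level H r (j + 1)).card + (level H r (j + 2)).card ≤ m * (level H r j).card := by
  classical
  rw [← Finset.card_union_of_disjoint]
  · refine (Finset.card_le_card (t := (level H r j).biUnion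
      fun u => {x | (square H).Adj u x ∧ j < H.dist r x}) ?_).trans ?_
    · intro x hx
      simp only [Finset.mem_union, mem_level] at hx
      obtain ⟨k, hk1, hk2, hk⟩ : ∃ k, 1 ≤ k ∧ k ≤ 2 ∧ H.dist r x = j + k := by
        rcases hx with hx | hx
        exacts [⟨1, by omega, by omega, hx⟩, ⟨2, by omega, by omega, hx⟩]
      obtain ⟨u, hu1, hu2⟩ := exists_between hc hk
      simp only [Finset.mem_biUnion, mem_level, Finset.mem_filter, Finset.mem_univ, true_and]
      refine ⟨u, hu1, square_adj_of_dist hc ?_ (by omega), by omega⟩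
      rintro rfl
      omega
    · rw [mul_comm]
      refine Finset.card_biUnion_le_card_mul _ _ _ fun u hu => ?_
      exact hm u (mem_level.1 hu) _ (by simp)
  · rw [Finset.disjoint_left]
    intro x h1 h2
    rw [mem_level] at h1 h2
    omega

theorem card_le_of_dist_le_seven (hc : H.Connected)
    (hcap : ∀ v, ∀ s : Finset V, (∀ x ∈ s, (square H).Adj v x) → s.card ≤ 6) (r : V)
    (hr : ∀ x, H.dist r x ≤ 7) : Fintype.card V ≤ 103 := by
  have step : ∀ j, (level H r (j + 1)).card + (level H r (j + 2)).card ≤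
      (6 - min j 2) * (level H r j).card := fun j =>
    card_level_add_le hc r j _ fun u hu s hs => by
      have := card_forward_le hc hcap hu hs
      omega
  have total : Fintype.card V = ∑ j ∈ Finset.range 8, (level H r j).card := by
    rw [← Finset.card_univ]
    refine Finset.card_eq_sum_card_fiberwise (f := H.dist r) fun x _ => ?_
    have := hr x
    simp only [Finset.coe_range, Set.mem_Iio]
    omega
  simp only [Finset.sum_range_succ, Finset.sum_range_zero, zero_add] at total
  have s0 := step 0
  have s1 := step 1
  have s2 := step 2
  have s3 := step 3
  have s4 := step 4
  have s5 := step 5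
  have s6 := step 6
  have c0 := card_level_zero hc r
  norm_num at s0 s1 s2 s3 s4 s5 s6
  rw [c0] at s0 total
  generalize (level H r 1).card = a1 at *
  generalize (level H r 2).card = a2 at *
  have h1 : a1 ≤ 6 := by omega
  have h2 : a2 ≤ 6 := by omega
  clear step hr
  interval_cases a1 <;> interval_cases a2 <;> omega

end SquareRoot

/-- A connected finite graph of maximum degree at most 6 that has no recognizable edges and has
a square root has at most 103 vertices. -/
theorem mainTheorem3 {V : Type*} [Fintype V] (G : SimpleGraph V) [DecidableRel G.Adj]
    (hconn : G.Connected) (hdeg : G.maxDegree ≤ 6)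
    (hrec : ∀ u v : V, ¬ SquareRoot.IsRecognizableEdge G u v)
    (hroot : ∃ H : SimpleGraph V, SquareRoot.IsSquareRoot H G) :
    Fintype.card V ≤ 103 := by
  obtain ⟨H, rfl⟩ := hroot
  have hc := SquareRoot.connected_of_connected_square hconn
  have hcap : ∀ v, ∀ s : Finset V, (∀ x ∈ s, (SquareRoot.square H).Adj v x) → s.card ≤ 6 := by
    intro v s hs
    refine (Finset.card_le_card (t := (SquareRoot.square H).neighborFinset v) fun x hx => ?_).trans
      (((SquareRoot.square H).degree_le_maxDegree v).trans hdeg)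
    rw [SimpleGraph.mem_neighborFinset]
    exact hs x hx
  obtain ⟨r⟩ := hconn.nonempty
  exact SquareRoot.card_le_of_dist_le_seven hc hcap r
    (SquareRoot.dist_le_seven hc hcap hrec r)
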